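/- Let $X$ be a reflexive real or complex Banach space and let $T$ be a power-bounded bounded linear operator on $X$, i.e. $\sup_{n}\|T^n\|<\infty$. For $x\in X$ let $Ex:=\lim_{n\to\infty}\frac1n\sum_{k=1}^n T^kx$ (norm limit; by reflexivity and power-boundedness it always exists) be the ergodic projection of $T$. Suppose that $T$ is weakly mixing, i.e. $$\lim_{n\to\infty}\frac1n\sum_{k=1}^n\bigl|\langle x^*,T^k(x-Ex)\rangle\bigr|=0\qquad\text{for all }x\in X,\ x^*\in X^*,$$ and that $T=\alpha I+S$ for some scalar $\alpha$ and some bounded linear operator $S$ on $X$ such that $S^k$ is compact for some $k\ge 1$. Then $T$ and its adjoint $T^*$ on $X^*$ are stable. Here a bounded linear operator $R$ on a Banach space $Y$ is called stable if it is mean ergodic, i.e. the norm limit $E(R)y:=\lim_{n\to\infty}\frac1n\sum_{k=1}^n R^ky$ exists for every $y\in Y$, and $\|R^ny-E(R)y\|\to0$ for every $y\in Y$ (that is, $R^n\to E(R)$ in the strong operator topology). -/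

import Mathlib

open Filter Topology

namespace ErgodicOperator

variable {𝕜 : Type*} [RCLike 𝕜]
variable {X : Type*} [NormedAddCommGroup X] [NormedSpace 𝕜 X]

variable (𝕜 X) in
/-- `X` is reflexive: the canonical embedding of `X` into its bidual is onto. -/
def IsReflexiveSpace : Prop :=
  Function.Surjective (NormedSpace.inclusionInDoubleDual 𝕜 X)

/-- `T` is power-bounded: `sup_n ‖T ^ n‖ < ∞`. -/
def IsPowerBounded (T : X →L[𝕜] X) : Prop :=
  ∃ C : ℝ, ∀ n : ℕ, ‖T ^ n‖ ≤ C

/-- The average `(1 / n) ∑_{k = 1}^n T ^ k x`. -/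
noncomputable def ergodicAverage (T : X →L[𝕜] X) (n : ℕ) (x : X) : X :=
  (n : 𝕜)⁻¹ • ∑ k ∈ Finset.Icc 1 n, (T ^ k) x

/-- `T` is mean ergodic: the averages `(1 / n) ∑_{k = 1}^n T ^ k x` converge in norm
for every `x`. -/
def IsMeanErgodic (T : X →L[𝕜] X) : Prop :=
  ∀ x : X, ∃ y : X, Tendsto (fun n : ℕ => ergodicAverage T n x) atTop (𝓝 y)

/-- The ergodic projection `E x = lim_n (1 / n) ∑_{k = 1}^n T ^ k x`.
The limit exists for every `x` exactly when `T` is mean ergodic, in particular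
for every power-bounded operator on a reflexive Banach space. -/
noncomputable def ergodicProjection (T : X →L[𝕜] X) (x : X) : X :=
  limUnder atTop (fun n : ℕ => ergodicAverage T n x)

/-- `T` is weakly mixing (a notion for power-bounded operators on reflexive spaces, where
the ergodic projection `E` exists): for all `x` and all continuous functionals `f`,
`(1 / n) ∑_{k = 1}^n |f (T ^ k (x - E x))| → 0`. -/
def IsWeaklyMixing (T : X →L[𝕜] X) : Prop :=
  ∀ (x : X) (f : StrongDual 𝕜 X),
    Tendsto
      (fun n : ℕ => (n : ℝ)⁻¹ * ∑ k ∈ Finset.Icc 1 n, ‖f ((T ^ k) (x - ergodicProjection T x))‖)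
      atTop (𝓝 0)

/-- `T` is stable: it is mean ergodic, and `‖T ^ n x - E x‖ → 0` for every `x`, where `E` is
the ergodic projection of `T`. -/
def IsStable (T : X →L[𝕜] X) : Prop :=
  IsMeanErgodic T ∧
    ∀ x : X, Tendsto (fun n : ℕ => ‖(T ^ n) x - ergodicProjection T x‖) atTop (𝓝 0)

/-- The Banach space adjoint `T* : X* → X*`, `T* f = f ∘ T`. -/
noncomputable def dualOperator (T : X →L[𝕜] X) : StrongDual 𝕜 X →L[𝕜] StrongDual 𝕜 X :=
  ContinuousLinearMap.precomp 𝕜 T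

end ErgodicOperator

namespace ErgodicOperator

section General

variable {𝕜 : Type*} [RCLike 𝕜]
variable {Y : Type*} [NormedAddCommGroup Y] [NormedSpace 𝕜 Y]

/-- A point outside a closed subspace is separated from it by a functional vanishing on it. -/
theorem exists_dual_vanishing_of_notMem (V : Submodule 𝕜 Y) (hV : IsClosed (V : Set Y))
    {x : Y} (hx : x ∉ V) : ∃ f : StrongDual 𝕜 Y, (∀ v ∈ V, f v = 0) ∧ f x ≠ 0 := by
  have : IsClosed (V : Set Y) := hV
  have hne : V.mkQL x ≠ 0 := by
    simpa [Submodule.Quotient.mk_eq_zero] using hx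
  obtain ⟨g, -, hg⟩ := exists_dual_vector 𝕜 (V.mkQL x) (norm_ne_zero_iff.2 hne)
  refine ⟨g.comp V.mkQL, fun v hv => ?_, ?_⟩
  · have : V.mkQL v = 0 := by simpa [Submodule.Quotient.mk_eq_zero] using hv
    rw [ContinuousLinearMap.comp_apply, this, map_zero]
  · rw [ContinuousLinearMap.comp_apply, hg]
    exact_mod_cast norm_ne_zero_iff.2 hne

/-- If `a n` tends weakly to zero and eventually `z - a n` lies in a closed subspace, then so
does `z`. -/
theorem mem_of_tendsto_dual (V : Submodule 𝕜 Y) (hV : IsClosed (V : Set Y)) {z : Y} {a : ℕ → Y}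
    (hmem : ∀ᶠ n in atTop, z - a n ∈ V)
    (ha : ∀ f : StrongDual 𝕜 Y, Tendsto (fun n => f (a n)) atTop (𝓝 0)) : z ∈ V := by
  by_contra hz
  obtain ⟨f, hf, hfz⟩ := exists_dual_vanishing_of_notMem V hV hz
  apply hfz
  refine tendsto_nhds_unique (f := fun _ : ℕ => f z) tendsto_const_nhds ((ha f).congr' ?_)
  filter_upwards [hmem] with n hn
  have := hf _ hn
  rw [map_sub, sub_eq_zero] at this
  exact this.symm

/-- For a power-bounded family of operators, the vectors along which it tends to zero
form a closed set. -/
theorem isClosed_setOf_tendsto_zero {A : ℕ → Y →L[𝕜] Y} {C : ℝ} (hA : ∀ n, ‖A n‖ ≤ C) :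
    IsClosed {z : Y | Tendsto (fun n => A n z) atTop (𝓝 0)} := by
  have hC : 0 ≤ C := (norm_nonneg _).trans (hA 0)
  rw [← isSeqClosed_iff_isClosed]
  intro u z hu hz
  rw [Set.mem_ofPred_eq, Metric.tendsto_atTop]
  intro ε hε
  obtain ⟨m, hm⟩ := ((Metric.tendsto_atTop.1 hz) (ε / (2 * (C + 1))) (by positivity))
  have hm := hm m le_rfl
  obtain ⟨N, hN⟩ := (Metric.tendsto_atTop.1 (hu m)) (ε / 2) (by positivity)
  refine ⟨N, fun n hn => ?_⟩
  have h1 := hN n hn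
  rw [dist_zero_right] at h1 ⊢
  rw [dist_eq_norm, ← norm_neg, neg_sub] at hm
  have h2 : ‖A n (z - u m)‖ ≤ C * ‖z - u m‖ := (A n).le_of_opNorm_le (hA n) _
  have h3 : C * ‖z - u m‖ ≤ (C + 1) * ‖z - u m‖ := by
    gcongr; linarith
  have h4 : (C + 1) * ‖z - u m‖ < ε / 2 := by
    calc (C + 1) * ‖z - u m‖ < (C + 1) * (ε / (2 * (C + 1))) := by gcongr
      _ = ε / 2 := by field_simp
  have h5 : A n z = A n (z - u m) + A n (u m) := by rw [← map_add, sub_add_cancel]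
  rw [h5]
  linarith [norm_add_le (A n (z - u m)) (A n (u m))]

/-- The subspace of vectors along which a sequence of operators tends to zero. -/
def nullSubmodule (A : ℕ → Y →L[𝕜] Y) : Submodule 𝕜 Y where
  carrier := {z : Y | Tendsto (fun n => A n z) atTop (𝓝 0)}
  zero_mem' := by simp
  add_mem' {a b} ha hb := by
    simpa [Set.mem_ofPred_eq] using Tendsto.add ha hb
  smul_mem' c a ha := by
    simpa [Set.mem_ofPred_eq] using Tendsto.const_smul ha c

theorem mem_nullSubmodule {A : ℕ → Y →L[𝕜] Y} {z : Y} :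
    z ∈ nullSubmodule A ↔ Tendsto (fun n => A n z) atTop (𝓝 0) := Iff.rfl

theorem mem_nullSubmodule_pow_apply {R : Y →L[𝕜] Y} {z : Y}
    (hz : z ∈ nullSubmodule fun n => R ^ n) : R z ∈ nullSubmodule fun n => R ^ n := by
  rw [mem_nullSubmodule] at hz ⊢
  refine ((tendsto_add_atTop_iff_nat 1).2 hz).congr fun n => ?_
  rw [pow_succ]; rfl

/-- The orbit of `z` is weakly null in the sense of Cesàro averages of absolute values. -/
def IsCesaroWeaklyNull (R : Y →L[𝕜] Y) (z : Y) : Prop :=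
  ∀ f : StrongDual 𝕜 Y,
    Tendsto (fun n : ℕ => (n : ℝ)⁻¹ * ∑ k ∈ Finset.Icc 1 n, ‖f ((R ^ k) z)‖) atTop (𝓝 0)

theorem IsCesaroWeaklyNull.apply_of_commute {R S : Y →L[𝕜] Y} (h : Commute R S) {z : Y}
    (hz : IsCesaroWeaklyNull R z) : IsCesaroWeaklyNull R (S z) := by
  intro f
  refine (hz (f.comp S)).congr fun n => ?_
  congr 1
  refine Finset.sum_congr rfl fun k _ => ?_
  have := DFunLike.congr_fun (h.pow_left k).eq z
  simp only [mul_apply_eq_comp] at this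
  rw [ContinuousLinearMap.comp_apply, this]

theorem IsCesaroWeaklyNull.exists_sum_lt {R : Y →L[𝕜] Y} {z : Y}
    (hz : IsCesaroWeaklyNull R z) {ι : Type*} (s : Finset ι) (f : ι → StrongDual 𝕜 Y)
    {ε : ℝ} (hε : 0 < ε) : ∃ k : ℕ, ∑ i ∈ s, ‖f i ((R ^ k) z)‖ < ε := by
  by_contra! hcon
  have hsum : Tendsto (fun n : ℕ => ∑ i ∈ s, (n : ℝ)⁻¹ * ∑ k ∈ Finset.Icc 1 n, ‖f i ((R ^ k) z)‖)
      atTop (𝓝 0) := by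
    simpa using tendsto_finsetSum s fun i _ => hz (f i)
  obtain ⟨n, hn, hn1⟩ := ((hsum.eventually (gt_mem_nhds hε)).and (eventually_ge_atTop 1)).exists
  rw [← Finset.mul_sum, Finset.sum_comm] at hn
  have h1 : (n : ℝ) * ε ≤ ∑ k ∈ Finset.Icc 1 n, ∑ i ∈ s, ‖f i ((R ^ k) z)‖ := by
    calc (n : ℝ) * ε = ∑ k ∈ Finset.Icc 1 n, ε := by simp
      _ ≤ _ := Finset.sum_le_sum fun k _ => hcon k
  have hn0 : (0 : ℝ) < n := by exact_mod_cast hn1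
  rw [inv_mul_lt_iff₀ hn0] at hn
  linarith

/-- If `R = α + S` is power-bounded, `z` has a Cesàro weakly null orbit and `R ^ n S z → 0`,
then `R ^ n z → 0`. -/
theorem mem_nullSubmodule_of_sub_smul {R S : Y →L[𝕜] Y} {α : 𝕜} {C : ℝ}
    (hC : ∀ n, ‖R ^ n‖ ≤ C) (hR : R = α • ContinuousLinearMap.id 𝕜 Y + S) {z : Y}
    (hz : IsCesaroWeaklyNull R z) (hS : S z ∈ nullSubmodule fun n => R ^ n) :
    z ∈ nullSubmodule fun n => R ^ n := by
  set V : Submodule 𝕜 Y := nullSubmodule fun n => R ^ n with hVdef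
  have hV : IsClosed (V : Set Y) := isClosed_setOf_tendsto_zero hC
  have hstep : R z - α • z ∈ V := by
    have : R z - α • z = S z := by rw [hR]; simp
    rwa [this]
  have hpow : ∀ j : ℕ, (R ^ j) z - α ^ j • z ∈ V := by
    intro j
    induction j with
    | zero => simp
    | succ j ih =>
      have : (R ^ (j + 1)) z - α ^ (j + 1) • z
          = R ((R ^ j) z - α ^ j • z) + α ^ j • (R z - α • z) := by
        rw [pow_succ' R, mul_apply_eq_comp, map_sub, map_smul, smul_sub, smul_smul,
          pow_succ]
        abel
      rw [this]
      exact V.add_mem (mem_nullSubmodule_pow_apply ih) (V.smul_mem _ hstep)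
  have hC0 : 0 ≤ C := (norm_nonneg _).trans (hC 0)
  rcases lt_or_ge ‖α‖ 1 with hα | hα
  · rw [hVdef, mem_nullSubmodule, Metric.tendsto_atTop]
    intro ε hε
    have h0 : Tendsto (fun j : ℕ => C * (‖α‖ ^ j * ‖z‖)) atTop (𝓝 0) := by
      simpa using ((tendsto_pow_atTop_nhds_zero_of_lt_one (norm_nonneg α) hα).mul_const
        ‖z‖).const_mul C
    obtain ⟨j, hj⟩ := (h0.eventually (gt_mem_nhds (half_pos hε))).exists
    obtain ⟨N, hN⟩ := (Metric.tendsto_atTop.1 (mem_nullSubmodule.1 (hpow j))) _ (half_pos hε)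
    refine ⟨N + j, fun n hn => ?_⟩
    obtain ⟨m, rfl⟩ : ∃ m, n = m + j := ⟨n - j, by omega⟩
    have h1 := hN m (by omega)
    rw [dist_zero_right] at h1 ⊢
    have h2 : (R ^ (m + j)) z = (R ^ m) ((R ^ j) z - α ^ j • z) + (R ^ m) (α ^ j • z) := by
      rw [← map_add, sub_add_cancel, pow_add]; rfl
    have h3 : ‖(R ^ m) (α ^ j • z)‖ ≤ C * (‖α‖ ^ j * ‖z‖) := by
      refine ((R ^ m).le_of_opNorm_le (hC m) _).trans_eq ?_
      rw [norm_smul, norm_pow]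
    rw [h2]
    linarith [norm_add_le ((R ^ m) ((R ^ j) z - α ^ j • z)) ((R ^ m) (α ^ j • z))]
  · have hα0 : α ≠ 0 := norm_pos_iff.1 (by linarith)
    refine mem_of_tendsto_dual V hV
      (a := fun n => (n : 𝕜)⁻¹ • ∑ k ∈ Finset.Icc 1 n, (α ^ k)⁻¹ • (R ^ k) z) ?_ fun f => ?_
    · filter_upwards [eventually_ge_atTop 1] with n hn
      have hn0 : (n : 𝕜) ≠ 0 := by exact_mod_cast (by omega : n ≠ 0)
      have : z - (n : 𝕜)⁻¹ • ∑ k ∈ Finset.Icc 1 n, (α ^ k)⁻¹ • (R ^ k) z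
          = (n : 𝕜)⁻¹ • ∑ k ∈ Finset.Icc 1 n, -((α ^ k)⁻¹ • ((R ^ k) z - α ^ k • z)) := by
        have h1 : ∀ k : ℕ, -((α ^ k)⁻¹ • ((R ^ k) z - α ^ k • z))
            = z - (α ^ k)⁻¹ • (R ^ k) z := fun k => by
          rw [smul_sub, smul_smul, inv_mul_cancel₀ (pow_ne_zero k hα0), one_smul, neg_sub]
        simp_rw [h1]
        rw [Finset.sum_sub_distrib, smul_sub, Finset.sum_const, Nat.card_Icc, Nat.add_sub_cancel,
          ← Nat.cast_smul_eq_nsmul 𝕜, smul_smul, inv_mul_cancel₀ hn0, one_smul]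
      rw [this]
      exact V.smul_mem _ (V.sum_mem fun k _ => V.neg_mem (V.smul_mem _ (hpow k)))
    · refine squeeze_zero_norm (fun n => ?_) (hz f)
      rw [map_smul, map_sum, norm_smul, norm_inv, RCLike.norm_natCast]
      refine mul_le_mul_of_nonneg_left ?_ (by positivity)
      refine (norm_sum_le _ _).trans (Finset.sum_le_sum fun k _ => ?_)
      rw [map_smul, norm_smul, norm_inv, norm_pow]
      exact mul_le_of_le_one_left (norm_nonneg _) (inv_le_one_of_one_le₀ (one_le_pow₀ hα))

theorem pow_apply_commute {R S : Y →L[𝕜] Y} (h : Commute R S) (n : ℕ) (z : Y) :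
    (R ^ n) (S z) = S ((R ^ n) z) := by
  simpa using DFunLike.congr_fun (h.pow_left n).eq z

/-- Orbits of a power-bounded operator that come arbitrarily close to zero converge to zero. -/
theorem mem_nullSubmodule_of_exists_lt {R : Y →L[𝕜] Y} {C : ℝ} (hC : ∀ n, ‖R ^ n‖ ≤ C) {z : Y}
    (hz : ∀ ε > 0, ∃ n : ℕ, ‖(R ^ n) z‖ < ε) : z ∈ nullSubmodule fun n => R ^ n := by
  have hC0 : 0 ≤ C := (norm_nonneg _).trans (hC 0)
  rw [mem_nullSubmodule, Metric.tendsto_atTop]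
  intro ε hε
  obtain ⟨N, hN⟩ := hz (ε / (C + 1)) (by positivity)
  refine ⟨N, fun n hn => ?_⟩
  obtain ⟨m, rfl⟩ : ∃ m, n = m + N := ⟨n - N, by omega⟩
  rw [dist_zero_right, pow_add, mul_apply_eq_comp]
  calc ‖(R ^ m) ((R ^ N) z)‖ ≤ C * ‖(R ^ N) z‖ := (R ^ m).le_of_opNorm_le (hC m) _
    _ ≤ (C + 1) * ‖(R ^ N) z‖ := by gcongr; linarith
    _ < (C + 1) * (ε / (C + 1)) := by gcongr
    _ = ε := by field_simp

theorem commute_of_eq_smul_id_add {R S : Y →L[𝕜] Y} {α : 𝕜}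
    (hR : R = α • ContinuousLinearMap.id 𝕜 Y + S) : Commute R S := by
  rw [hR]
  ext x
  simp

/-- If `R = α + S` is power-bounded and orbits of `S ^ k z` approach zero for all `z` with
Cesàro weakly null orbit, then all such orbits are norm null. -/
theorem IsCesaroWeaklyNull.tendsto_zero {R S : Y →L[𝕜] Y} {α : 𝕜} {k : ℕ}
    (hpb : IsPowerBounded R) (hR : R = α • ContinuousLinearMap.id 𝕜 Y + S)
    (hS : ∀ z, IsCesaroWeaklyNull R z → ∀ ε > 0, ∃ n : ℕ, ‖(R ^ n) ((S ^ k) z)‖ < ε)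
    {z : Y} (hz : IsCesaroWeaklyNull R z) :
    Tendsto (fun n : ℕ => (R ^ n) z) atTop (𝓝 0) := by
  obtain ⟨C, hC⟩ := hpb
  have hcomm := commute_of_eq_smul_id_add hR
  induction k with
  | zero => exact mem_nullSubmodule_of_exists_lt hC (by simpa using hS z hz)
  | succ k ih =>
    refine ih fun w hw ε hε => ?_
    have h1 : (S ^ k) w ∈ nullSubmodule fun n => R ^ n := by
      refine mem_nullSubmodule_of_sub_smul hC hR (hw.apply_of_commute (hcomm.pow_right k)) ?_
      refine mem_nullSubmodule_of_exists_lt hC fun δ hδ => ?_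
      simpa [pow_succ'] using hS w hw δ hδ
    obtain ⟨N, hN⟩ := (Metric.tendsto_atTop.1 (mem_nullSubmodule.1 h1)) ε hε
    exact ⟨N, by simpa using hN N le_rfl⟩

theorem norm_ergodicAverage_le {R : Y →L[𝕜] Y} {C : ℝ} (hC : ∀ n, ‖R ^ n‖ ≤ C) (n : ℕ) (x : Y) :
    ‖ergodicAverage R n x‖ ≤ C * ‖x‖ := by
  have hC0 : 0 ≤ C := (norm_nonneg _).trans (hC 0)
  rcases Nat.eq_zero_or_pos n with rfl | hn
  · simp only [ergodicAverage]; simp; positivity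
  have hn0 : (0 : ℝ) < n := by exact_mod_cast hn
  rw [ergodicAverage, norm_smul, norm_inv, RCLike.norm_natCast, inv_mul_le_iff₀ hn0]
  calc ‖∑ k ∈ Finset.Icc 1 n, (R ^ k) x‖ ≤ ∑ k ∈ Finset.Icc 1 n, C * ‖x‖ :=
        norm_sum_le_of_le _ fun k _ => (R ^ k).le_of_opNorm_le (hC k) _
    _ = n * (C * ‖x‖) := by simp

theorem ergodicAverage_sub (R : Y →L[𝕜] Y) (n : ℕ) (x y : Y) :
    ergodicAverage R n (x - y) = ergodicAverage R n x - ergodicAverage R n y := by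
  simp [ergodicAverage, smul_sub]

theorem ergodicAverage_of_fixed {R : Y →L[𝕜] Y} {x : Y} (hx : R x = x) {n : ℕ} (hn : 1 ≤ n) :
    ergodicAverage R n x = x := by
  have h : ∀ k : ℕ, (R ^ k) x = x := fun k => by
    induction k with
    | zero => simp
    | succ k ih => rw [pow_succ, mul_apply_eq_comp, hx, ih]
  have hn0 : (n : 𝕜) ≠ 0 := by exact_mod_cast (by omega : n ≠ 0)
  simp only [ergodicAverage, h, Finset.sum_const, Nat.card_Icc, Nat.add_sub_cancel]
  rw [← Nat.cast_smul_eq_nsmul 𝕜, smul_smul, inv_mul_cancel₀ hn0, one_smul]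

theorem apply_ergodicAverage (R : Y →L[𝕜] Y) (n : ℕ) (x : Y) :
    R (ergodicAverage R n x) = ergodicAverage R n (R x) := by
  simp only [ergodicAverage, map_smul, map_sum]
  congr 1
  refine Finset.sum_congr rfl fun k _ => ?_
  exact (pow_apply_commute (Commute.refl R) k x).symm

theorem tendsto_ergodicAverage_sub_apply {R : Y →L[𝕜] Y} (hpb : IsPowerBounded R) (x : Y) :
    Tendsto (fun n => ergodicAverage R n (x - R x)) atTop (𝓝 0) := by
  obtain ⟨C, hC⟩ := hpb
  have key : ∀ n : ℕ, ergodicAverage R n (x - R x) = (n : 𝕜)⁻¹ • (R x - (R ^ (n + 1)) x) := by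
    intro n
    rw [ergodicAverage]
    congr 1
    induction n with
    | zero => simp
    | succ n ih =>
      rw [Finset.sum_Icc_succ_top (by omega), ih, map_sub, pow_succ R (n + 1),
        mul_apply_eq_comp]
      abel
  refine squeeze_zero_norm (a := fun n : ℕ => (n : ℝ)⁻¹ * (‖R x‖ + C * ‖x‖)) (fun n => ?_) ?_
  · rw [key, norm_smul, norm_inv, RCLike.norm_natCast]
    refine mul_le_mul_of_nonneg_left ((norm_sub_le _ _).trans ?_) (by positivity)
    gcongr
    exact (R ^ (n + 1)).le_of_opNorm_le (hC _) _
  · simpa using (tendsto_inv_atTop_nhds_zero_nat (𝕜 := ℝ)).mul_const (‖R x‖ + C * ‖x‖)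

theorem IsMeanErgodic.tendsto_ergodicProjection {R : Y →L[𝕜] Y} (h : IsMeanErgodic R) (x : Y) :
    Tendsto (fun n => ergodicAverage R n x) atTop (𝓝 (ergodicProjection R x)) :=
  tendsto_nhds_limUnder (h x)

theorem IsMeanErgodic.apply_ergodicProjection {R : Y →L[𝕜] Y} (hpb : IsPowerBounded R)
    (h : IsMeanErgodic R) (x : Y) : R (ergodicProjection R x) = ergodicProjection R x := by
  have h1 := h.tendsto_ergodicProjection x
  have h2 := (R.continuous.tendsto _).comp h1
  have h3 := h1.sub h2
  have h4 : ergodicProjection R x - R (ergodicProjection R x) = 0 := by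
    refine tendsto_nhds_unique h3 ((tendsto_ergodicAverage_sub_apply hpb x).congr fun n => ?_)
    rw [ergodicAverage_sub, Function.comp_apply, apply_ergodicAverage]
  exact (sub_eq_zero.1 h4).symm

/-- In a reflexive space a bounded sequence converges weakly along any ultrafilter. -/
theorem exists_weak_limit_ultrafilter (hY : IsReflexiveSpace 𝕜 Y) (U : Ultrafilter ℕ)
    {a : ℕ → Y} {M : ℝ} (ha : ∀ n, ‖a n‖ ≤ M) :
    ∃ y : Y, ∀ f : StrongDual 𝕜 Y, Tendsto (fun n => f (a n)) U (𝓝 (f y)) := by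
  let J : ℕ → WeakDual 𝕜 (StrongDual 𝕜 Y) := fun n =>
    StrongDual.toWeakDual (NormedSpace.inclusionInDoubleDual 𝕜 Y (a n))
  obtain ⟨φ, -, hφ⟩ := (WeakDual.isCompact_closedBall (𝕜 := 𝕜)
    (0 : StrongDual 𝕜 (StrongDual 𝕜 Y)) M).ultrafilter_le_nhds' (U.map J) (by
      refine mem_map.2 (Filter.univ_mem' fun n => ?_)
      simp only [Set.mem_preimage, mem_closedBall_zero_iff]
      exact (NormedSpace.double_dual_bound 𝕜 Y (a n)).trans (ha n))
  obtain ⟨y, hy⟩ := hY (WeakDual.toStrongDual φ)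
  refine ⟨y, fun f => ?_⟩
  have h1 : Tendsto (fun n => J n f) U (𝓝 (φ f)) :=
    ((WeakDual.eval_continuous f).tendsto φ).comp (show Tendsto J U (𝓝 φ) from hφ)
  have h2 : φ f = f y := by
    rw [← NormedSpace.dual_def 𝕜 Y, hy]; rfl
  rw [← h2]
  exact h1

/-- The mean ergodic theorem for power-bounded operators on reflexive spaces. -/
theorem isMeanErgodic_of_isReflexiveSpace (hY : IsReflexiveSpace 𝕜 Y) {R : Y →L[𝕜] Y}
    (hpb : IsPowerBounded R) : IsMeanErgodic R := by
  intro x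
  obtain ⟨C, hC⟩ := id hpb
  obtain ⟨y, hy⟩ := exists_weak_limit_ultrafilter hY (hyperfilter ℕ)
    (a := fun n => ergodicAverage R n x) (norm_ergodicAverage_le hC · x)
  have hU : (hyperfilter ℕ : Filter ℕ) ≤ atTop := by
    rw [← Nat.cofinite_eq_atTop]; exact hyperfilter_le_cofinite
  have hfix : R y = y := by
    rw [SeparatingDual.eq_iff_forall_dual_eq (R := 𝕜)]
    intro f
    have h1 := (hy f).sub (hy (f.comp R))
    have h2 := ((f.continuous.tendsto _).comp (tendsto_ergodicAverage_sub_apply hpb x)).mono_left hU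
    rw [map_zero] at h2
    have h3 : f y - (f.comp R) y = 0 := tendsto_nhds_unique h1 (h2.congr fun n => by
      rw [Function.comp_apply, ergodicAverage_sub, map_sub, ContinuousLinearMap.comp_apply,
        apply_ergodicAverage])
    exact (sub_eq_zero.1 h3).symm
  let A : ℕ → Y →L[𝕜] Y := fun n => (n : 𝕜)⁻¹ • ∑ k ∈ Finset.Icc 1 n, R ^ k
  have hA : ∀ n z, A n z = ergodicAverage R n z := fun n z => by
    simp [A, ergodicAverage]
  have hAC : ∀ n, ‖A n‖ ≤ C := fun n =>
    (A n).opNorm_le_bound ((norm_nonneg _).trans (hC 0)) fun z => by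
      rw [hA]; exact norm_ergodicAverage_le hC n z
  have hsub : ∀ z, z - R z ∈ nullSubmodule A := fun z => by
    simp only [mem_nullSubmodule, hA]; exact tendsto_ergodicAverage_sub_apply hpb z
  have hpow : ∀ k : ℕ, x - (R ^ k) x ∈ nullSubmodule A := fun k => by
    induction k with
    | zero => simp
    | succ k ih =>
      have : x - (R ^ (k + 1)) x = (x - (R ^ k) x) + ((R ^ k) x - R ((R ^ k) x)) := by
        rw [pow_succ', mul_apply_eq_comp]; abel
      rw [this]
      exact Submodule.add_mem _ ih (hsub _)
  have hmem : x - y ∈ nullSubmodule A := by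
    by_contra hcon
    obtain ⟨f, hf, hfx⟩ := exists_dual_vanishing_of_notMem _ (isClosed_setOf_tendsto_zero hAC) hcon
    apply hfx
    rw [map_sub, sub_eq_zero]
    refine tendsto_nhds_unique (f := fun _ : ℕ => f x) tendsto_const_nhds ((hy f).congr' ?_)
    filter_upwards [hU (eventually_ge_atTop 1)] with n hn
    have hn0 : (n : 𝕜) ≠ 0 := by exact_mod_cast (by omega : n ≠ 0)
    have h1 : ∀ k : ℕ, f ((R ^ k) x) = f x := fun k => by
      have := hf _ (hpow k)
      rw [map_sub, sub_eq_zero] at this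
      exact this.symm
    rw [ergodicAverage, map_smul, map_sum]
    rw [Finset.sum_congr rfl fun k _ => h1 k]
    simp [hn0]
  refine ⟨y, ?_⟩
  have h1 : Tendsto (fun n => ergodicAverage R n (x - y) + y) atTop (𝓝 (0 + y)) := by
    refine Tendsto.add_const y ?_
    simpa only [mem_nullSubmodule, hA] using hmem
  rw [zero_add] at h1
  refine h1.congr' ?_
  filter_upwards [eventually_ge_atTop 1] with n hn
  rw [ergodicAverage_sub, ergodicAverage_of_fixed hfix hn, sub_add_cancel]

/-- A mean ergodic, power-bounded operator is stable as soon as the orbits of all vectors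
`x - E x` tend to zero. -/
theorem isStable_of_tendsto_zero {R : Y →L[𝕜] Y} (hpb : IsPowerBounded R) (hme : IsMeanErgodic R)
    (h : ∀ x, Tendsto (fun n : ℕ => (R ^ n) (x - ergodicProjection R x)) atTop (𝓝 0)) :
    IsStable R := by
  refine ⟨hme, fun x => ?_⟩
  have hfix := hme.apply_ergodicProjection hpb x
  refine (tendsto_zero_iff_norm_tendsto_zero.1 (h x)).congr fun n => ?_
  have h1 : (R ^ n) (ergodicProjection R x) = ergodicProjection R x := by
    induction n with
    | zero => simp
    | succ n ih => rw [pow_succ, mul_apply_eq_comp, hfix, ih]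
  rw [map_sub, h1]

/-- A compact operator maps some vector of a Cesàro weakly null orbit close to zero. -/
theorem IsCesaroWeaklyNull.exists_norm_compact_lt {R K : Y →L[𝕜] Y} (hpb : IsPowerBounded R)
    (hK : IsCompactOperator K) {z : Y} (hz : IsCesaroWeaklyNull R z) {ε : ℝ} (hε : 0 < ε) :
    ∃ n : ℕ, ‖K ((R ^ n) z)‖ < ε := by
  obtain ⟨C, hC⟩ := hpb
  have hcpt := hK.isCompact_closure_image_closedBall (f := (K : Y →ₗ[𝕜] Y)) (C * ‖z‖)
  obtain ⟨t, -, htf, ht⟩ := hcpt.finite_cover_balls (e := ε / 3) (by positivity)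
  choose g hg1 hg2 using fun y : Y => exists_dual_vector'' 𝕜 y
  obtain ⟨n, hn⟩ := hz.exists_sum_lt htf.toFinset (fun y => (g y).comp K)
    (ε := ε / 3) (by positivity)
  refine ⟨n, ?_⟩
  have hmem : K ((R ^ n) z) ∈ closure ((K : Y →ₗ[𝕜] Y) '' Metric.closedBall 0 (C * ‖z‖)) :=
    subset_closure ⟨_, by simpa using (R ^ n).le_of_opNorm_le (hC n) z, rfl⟩
  obtain ⟨y, hyt, hy⟩ := Set.mem_iUnion₂.1 (ht hmem)
  rw [Metric.mem_ball, dist_eq_norm] at hy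
  set w := K ((R ^ n) z)
  have h1 : ‖g y w‖ < ε / 3 :=
    (Finset.single_le_sum (f := fun y => ‖((g y).comp K) ((R ^ n) z)‖)
      (fun _ _ => norm_nonneg _) (htf.mem_toFinset.2 hyt)).trans_lt hn
  have h2 : ‖y‖ ≤ ‖g y w‖ + ‖w - y‖ := by
    have h3 : ‖g y y‖ = ‖y‖ := by rw [hg2]; simp
    have h4 : g y y = g y w - g y (w - y) := by rw [← map_sub, sub_sub_cancel]
    rw [← h3, h4]
    refine (norm_sub_le _ _).trans (add_le_add_right ?_ _)
    simpa using (g y).le_of_opNorm_le (hg1 y) (w - y)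
  have h5 : ‖w‖ ≤ ‖y‖ + ‖w - y‖ := by
    simpa using norm_add_le y (w - y)
  linarith

/-- The dual of a reflexive space is reflexive. -/
theorem IsReflexiveSpace.dual (hY : IsReflexiveSpace 𝕜 Y) :
    IsReflexiveSpace 𝕜 (StrongDual 𝕜 Y) := by
  intro Φ
  refine ⟨Φ.comp (NormedSpace.inclusionInDoubleDual 𝕜 Y), ?_⟩
  ext φ
  obtain ⟨x, rfl⟩ := hY φ
  rfl

theorem dualOperator_pow_apply (T : Y →L[𝕜] Y) (n : ℕ) (f : StrongDual 𝕜 Y) (x : Y) :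
    ((dualOperator T) ^ n) f x = f ((T ^ n) x) := by
  induction n generalizing f with
  | zero => simp
  | succ n ih =>
    rw [pow_succ, mul_apply_eq_comp, ih, pow_succ']
    rfl

theorem IsPowerBounded.dualOperator {T : Y →L[𝕜] Y} (hpb : IsPowerBounded T) :
    IsPowerBounded (dualOperator T) := by
  obtain ⟨C, hC⟩ := hpb
  have hC0 : 0 ≤ C := (norm_nonneg _).trans (hC 0)
  refine ⟨C, fun n => ContinuousLinearMap.opNorm_le_bound _ hC0 fun f =>
    ContinuousLinearMap.opNorm_le_bound _ (by positivity) fun x => ?_⟩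
  rw [dualOperator_pow_apply]
  calc ‖f ((T ^ n) x)‖ ≤ ‖f‖ * (C * ‖x‖) :=
        f.le_opNorm_of_le ((T ^ n).le_of_opNorm_le (hC n) x)
    _ = C * ‖f‖ * ‖x‖ := by ring

theorem ergodicAverage_dualOperator_apply (T : Y →L[𝕜] Y) (n : ℕ) (f : StrongDual 𝕜 Y) (x : Y) :
    ergodicAverage (dualOperator T) n f x = f (ergodicAverage T n x) := by
  simp only [ergodicAverage, smul_apply, sum_apply,
    dualOperator_pow_apply, map_smul, map_sum]

theorem ergodicProjection_dualOperator_apply {T : Y →L[𝕜] Y} (hT : IsMeanErgodic T)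
    (hT' : IsMeanErgodic (dualOperator T)) (f : StrongDual 𝕜 Y) (x : Y) :
    ergodicProjection (dualOperator T) f x = f (ergodicProjection T x) := by
  have h1 := ((NormedSpace.inclusionInDoubleDual 𝕜 Y x).continuous.tendsto _).comp
    (hT'.tendsto_ergodicProjection f)
  have h2 := (f.continuous.tendsto _).comp (hT.tendsto_ergodicProjection x)
  refine tendsto_nhds_unique h1 (h2.congr fun n => ?_)
  exact (ergodicAverage_dualOperator_apply T n f x).symm

/-- The adjoint of a weakly mixing operator on a reflexive space is weakly mixing. -/
theorem IsWeaklyMixing.dualOperator (hY : IsReflexiveSpace 𝕜 Y) {T : Y →L[𝕜] Y}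
    (hpb : IsPowerBounded T) (hwm : IsWeaklyMixing T) : IsWeaklyMixing (dualOperator T) := by
  have hme := isMeanErgodic_of_isReflexiveSpace hY hpb
  have hme' := isMeanErgodic_of_isReflexiveSpace hY.dual hpb.dualOperator
  intro f φ
  obtain ⟨x, rfl⟩ := hY φ
  refine (hwm x f).congr fun n => ?_
  congr 1
  refine Finset.sum_congr rfl fun k _ => ?_
  have hfix := hme.apply_ergodicProjection hpb x
  have hcomm : ergodicProjection T ((T ^ k) x) = (T ^ k) (ergodicProjection T x) := by
    refine tendsto_nhds_unique (hme.tendsto_ergodicProjection _)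
      ((((T ^ k).continuous.tendsto _).comp (hme.tendsto_ergodicProjection x)).congr fun n => ?_)
    simp only [Function.comp_apply, ergodicAverage, map_smul, map_sum]
    congr 1
    refine Finset.sum_congr rfl fun j _ => ?_
    rw [pow_apply_commute ((Commute.refl T).pow_right k) j x]
  rw [NormedSpace.dual_def, dualOperator_pow_apply, sub_apply,
    ergodicProjection_dualOperator_apply hme hme', hcomm, map_sub, map_sub]

/-- If the orbit of a functional `f` under the adjoint is Cesàro weakly null, then composing it
with a compact operator gives a functional of small norm for some time. -/
theorem IsCesaroWeaklyNull.exists_norm_comp_compact_lt {T K : Y →L[𝕜] Y} (hpb : IsPowerBounded T)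
    (hK : IsCompactOperator K) {f : StrongDual 𝕜 Y}
    (hf : IsCesaroWeaklyNull (ErgodicOperator.dualOperator T) f) {ε : ℝ} (hε : 0 < ε) :
    ∃ n : ℕ, ‖(((ErgodicOperator.dualOperator T) ^ n) f).comp K‖ < ε := by
  obtain ⟨C, hC⟩ := hpb.dualOperator
  have hC0 : 0 ≤ C := (norm_nonneg _).trans (hC 0)
  set δ : ℝ := ε / (4 * (C * ‖f‖ + 1)) with hδ
  have hδ0 : 0 < δ := by positivity
  have hcpt := hK.isCompact_closure_image_closedBall (f := (K : Y →ₗ[𝕜] Y)) 1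
  obtain ⟨t, -, htf, ht⟩ := hcpt.finite_cover_balls (e := δ) hδ0
  obtain ⟨n, hn⟩ := hf.exists_sum_lt htf.toFinset
    (fun y => NormedSpace.inclusionInDoubleDual 𝕜 Y y) (ε := ε / 4) (by positivity)
  refine ⟨n, ?_⟩
  set g := ((ErgodicOperator.dualOperator T) ^ n) f
  have hg : ‖g‖ ≤ C * ‖f‖ := ((ErgodicOperator.dualOperator T) ^ n).le_of_opNorm_le (hC n) f
  refine lt_of_le_of_lt (ContinuousLinearMap.opNorm_le_of_unit_norm (C := ε / 2)
    (by positivity) fun x hx => ?_) (half_lt_self hε)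
  have hmem : K x ∈ closure ((K : Y →ₗ[𝕜] Y) '' Metric.closedBall 0 1) :=
    subset_closure ⟨x, by simp [hx], rfl⟩
  obtain ⟨y, hyt, hy⟩ := Set.mem_iUnion₂.1 (ht hmem)
  rw [Metric.mem_ball, dist_eq_norm] at hy
  have h1 : ‖g y‖ < ε / 4 :=
    (Finset.single_le_sum (f := fun y => ‖NormedSpace.inclusionInDoubleDual 𝕜 Y y g‖)
      (fun _ _ => norm_nonneg _) (htf.mem_toFinset.2 hyt)).trans_lt hn
  have h2 : ‖g (K x - y)‖ ≤ ε / 4 := by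
    calc ‖g (K x - y)‖ ≤ (C * ‖f‖ + 1) * δ :=
          (g.le_of_opNorm_le (hg.trans (lt_add_one (C * ‖f‖)).le) _).trans (by gcongr)
      _ = ε / 4 := by rw [hδ]; field_simp
  have h3 : g (K x) = g y + g (K x - y) := by rw [← map_add, add_sub_cancel]
  rw [ContinuousLinearMap.comp_apply, h3]
  linarith [norm_add_le (g y) (g (K x - y))]

end General

end ErgodicOperator

open ErgodicOperator in
theorem mainTheorem2 {𝕜 : Type*} [RCLike 𝕜]
    {X : Type*} [NormedAddCommGroup X] [NormedSpace 𝕜 X] [CompleteSpace X]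
    (hX : ErgodicOperator.IsReflexiveSpace 𝕜 X)
    (T : X →L[𝕜] X)
    (hpb : ErgodicOperator.IsPowerBounded T)
    (hwm : ErgodicOperator.IsWeaklyMixing T)
    (hT : ∃ (α : 𝕜) (S : X →L[𝕜] X) (k : ℕ),
      1 ≤ k ∧ T = α • ContinuousLinearMap.id 𝕜 X + S ∧ IsCompactOperator (S ^ k)) :
    ErgodicOperator.IsStable T ∧ ErgodicOperator.IsStable (ErgodicOperator.dualOperator T) := by
  obtain ⟨α, S, k, -, hTS, hK⟩ := hT
  have hcomm : Commute T S := commute_of_eq_smul_id_add hTS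
  constructor
  · refine isStable_of_tendsto_zero hpb (isMeanErgodic_of_isReflexiveSpace hX hpb) fun x => ?_
    refine IsCesaroWeaklyNull.tendsto_zero (k := k) hpb hTS (fun z hz ε hε => ?_) (hwm x)
    obtain ⟨n, hn⟩ := hz.exists_norm_compact_lt hpb hK hε
    exact ⟨n, by rwa [pow_apply_commute (hcomm.pow_right k)]⟩
  · have hTS' : dualOperator T
        = α • ContinuousLinearMap.id 𝕜 (StrongDual 𝕜 X) + dualOperator S := by
      ext f x
      simp [dualOperator, hTS]
    refine isStable_of_tendsto_zero hpb.dualOperator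
      (isMeanErgodic_of_isReflexiveSpace hX.dual hpb.dualOperator) fun f => ?_
    refine IsCesaroWeaklyNull.tendsto_zero (k := k) hpb.dualOperator hTS' (fun g hg ε hε => ?_)
      (hwm.dualOperator hX hpb f)
    obtain ⟨n, hn⟩ := hg.exists_norm_comp_compact_lt hpb hK hε
    refine ⟨n, lt_of_eq_of_lt (congrArg _ ?_) hn⟩
    rw [pow_apply_commute ((commute_of_eq_smul_id_add hTS').pow_right k)]
    ext x
    exact dualOperator_pow_apply S k _ x
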